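/- Let $\tau_1,\dots,\tau_N$ be sporadic tasks, where $\tau_i$ has worst-case execution time $C_i>0$, minimum inter-arrival time $T_i>0$ and relative deadline $D_i>0$, with $C_i/D_i\le 1$ and $U_i:=C_i/T_i\le 1$. Task $\tau_i$ releases an infinite sequence of jobs, from time $0$ on; consecutive releases of $\tau_i$ are separated by at least $T_i$, each job of $\tau_i$ requires an execution time of at most $C_i$, and a job of $\tau_i$ released at time $t$ has absolute deadline $t+D_i$. The tasks are executed on $M\ge 2$ identical unit-speed processors by global fixed-priority preemptive scheduling, where $\tau_i$ has higher priority than $\tau_j$ if $i<j$: at most one job of each task is executed at any time, the jobs of one task are executed in the order of their releases, and at every time the $M$ highest-priority ready jobs are executed (all of them if there are fewer than $M$), a job being ready if it has been released and is unfinished and all earlier jobs of its task are finished. Task $\tau_k$ is called schedulable if, for all releases and execution times as above, every job of $\tau_k$ finishes no later than its absolute deadline in the resulting schedule. Let $\delta_k = C_k/\min\{D_k,T_k\}$ and $U^{\max}_{\delta,k}=\max\{\max_{1\le i\le k-1}U_i,\ \delta_k\}$ (so $U^{\max}_{\delta,k}=\delta_k$ if $k=1$). Suppose that $D_k>T_k$,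 and let $b=\frac{D_k-T_k}{T_k}$. Then $\tau_k$ is schedulable in each of the following two cases: 1. $bU_k-\sum_{i=1}^{k-1}\frac{C_i-C_iU_i}{T_k}>0$ and $$\sum_{i=1}^{k}U_i\le M-(M-1)\,U^{\max}_{\delta,k};$$ 2. $bU_k-\sum_{i=1}^{k-1}\frac{C_i-C_iU_i}{T_k}\le 0$ and $$\frac{C_k}{D_k}+\sum_{i=1}^{k-1}\Big(\frac{C_i-C_iU_i}{D_k}+U_i\Big)\le M-(M-1)\,U^{\max}_{\delta,k}.$$ -/

import Mathlib

/-- A sporadic task: worst-case execution time `C`, minimum inter-arrival time (period) `T` and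
relative deadline `D`, with the standing assumptions that all three are positive, that `C / D ≤ 1`
and that the utilization `C / T` is at most `1`. The deadline is arbitrary: `D` may be smaller
than, equal to, or larger than `T`. -/
structure SporadicTask where
  C : ℝ
  T : ℝ
  D : ℝ
  C_pos : 0 < C
  T_pos : 0 < T
  D_pos : 0 < D
  C_div_D_le_one : C / D ≤ 1
  C_div_T_le_one : C / T ≤ 1

/-- Utilization `U = C / T`. -/
noncomputable def SporadicTask.U (s : SporadicTask) : ℝ := s.C / s.T

/-- Density `δ = C / min {D, T}`. -/
noncomputable def SporadicTask.density (s : SporadicTask) : ℝ := s.C / min s.D s.T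

namespace GlobalFP

variable {N : ℕ}

/-- `max {max_{i < k} U_i, δ_k}`; this is `δ_k` when there is no `i < k`. -/
noncomputable def UmaxDelta (τ : Fin N → SporadicTask) (k : Fin N) : ℝ :=
  (Finset.Iio k).fold max (τ k).density (fun i => (τ i).U)

/-- The behaviour of the jobs of a task set at run time: job `j` (`j = 0, 1, 2, …`) of task `i`
arrives at time `release i j` and needs `exec i j` units of execution time. -/
structure JobPattern (N : ℕ) where
  release : Fin N → ℕ → ℝ
  exec : Fin N → ℕ → ℝ

/-- The job patterns that a sporadic task set can generate: the system starts at time `0`, any two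
consecutive arrivals of a task are at least one period apart, and no job needs more than the
worst-case execution time of its task. -/
structure JobPattern.IsLegal (P : JobPattern N) (τ : Fin N → SporadicTask) : Prop where
  release_nonneg : ∀ i j, 0 ≤ P.release i j
  separation : ∀ i j, P.release i j + (τ i).T ≤ P.release i (j + 1)
  exec_nonneg : ∀ i j, 0 ≤ P.exec i j
  exec_le : ∀ i j, P.exec i j ≤ (τ i).C

/-- A candidate schedule: `S i j` is the set of the times at which job `j` of task `i` is being
executed, on any one of the unit-speed processors. -/
abbrev Schedule (N : ℕ) := Fin N → ℕ → Set ℝ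

/-- The amount of execution that job `j` of task `i` receives during `[0, t)`. -/
noncomputable def Schedule.service (S : Schedule N) (i : Fin N) (j : ℕ) (t : ℝ) : ℝ :=
  MeasureTheory.volume.real (S i j ∩ Set.Ico 0 t)

/-- Job `j` of task `i` has completed its execution by time `t`. -/
def Finished (P : JobPattern N) (S : Schedule N) (i : Fin N) (j : ℕ) (t : ℝ) : Prop :=
  P.exec i j ≤ S.service i j t

/-- Task `i` is active at time `t`: some job of it has arrived before or at `t` and has not
finished yet at `t`. -/
def Active (P : JobPattern N) (S : Schedule N) (i : Fin N) (t : ℝ) : Prop :=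
  ∃ j, P.release i j ≤ t ∧ ¬ Finished P S i j t

/-- Job `j` of task `i` is in the ready queue at time `t`: it has arrived, is not finished, and all
earlier jobs of its task are finished (jobs of one task are executed one after the other, in the
order of their arrivals, so there is no intra-task parallelism). -/
def Ready (P : JobPattern N) (S : Schedule N) (i : Fin N) (j : ℕ) (t : ℝ) : Prop :=
  P.release i j ≤ t ∧ ¬ Finished P S i j t ∧ ∀ j' < j, Finished P S i j' t

/-- `S` is the schedule that global fixed-priority preemptive scheduling on `M` identical
processors produces for the job pattern `P`, where a task with a smaller index has a higher
priority: at every time, exactly the `M` highest-priority jobs of the ready queue are executed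
(all of them if there are fewer than `M`). A task contributes a job to the ready queue exactly
when it is active, and then exactly one job, so a ready job of task `i` is among the `M`
highest-priority ones exactly when fewer than `M` tasks `h < i` are active. -/
structure IsGlobalFPSchedule (M : ℕ) (P : JobPattern N) (S : Schedule N) : Prop where
  measurable : ∀ i j, MeasurableSet (S i j)
  executes_iff : ∀ i j t,
    t ∈ S i j ↔ Ready P S i j t ∧ {h : Fin N | h < i ∧ Active P S h t}.ncard < M

/-- Task `τ_k` is schedulable under global fixed-priority preemptive scheduling on `M` identical
processors: in every schedule, for every legal job pattern of the task set, every job of `τ_k`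
finishes no later than its absolute deadline. -/
def Schedulable (M : ℕ) (τ : Fin N → SporadicTask) (k : Fin N) : Prop :=
  ∀ (P : JobPattern N) (S : Schedule N), P.IsLegal τ → IsGlobalFPSchedule M P S →
    ∀ j, Finished P S k j (P.release k j + (τ k).D)

end GlobalFP

/-!
Write `V` for `UmaxDelta τ k` and `ρ = M - (M - 1) V`. Suppose that a job of task `k` misses its
deadline `d`, and let `a` be the start of the busy period of task `k` around the miss. On `[a, d)`,
task `k` works for at most `V (d - a)`, and whenever it is not running, `M` tasks of higher priority
are; hence task `k` and the tasks above it together work for at least `ρ (d - a)`. Extend `[a, d)`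
to the left, to the earliest `s ≥ 0` at which this total still reaches `ρ (d - s)`. If a task
`i < k` has unfinished work at `s`, from a busy period starting at `u < s`, then the same counting
on `[u, s)` and the minimality of `s` show that it has run for more than
`V (s - u) ≥ U_i (s - u)` there. So carry-in costs nothing, and every `i < k` works for at
most `U_i L + C_i - C_i U_i` in `[s, d)`, where `L = d - s ≥ D_k`. The resulting load bound is affine in `L`, so it stays below
`ρ L` as soon as it does so at `L = D_k` and its slope `∑ i ≤ k, U_i` is at most `ρ`. The sign
condition of the theorem tells which of these two requirements implies the other.
-/

open MeasureTheory Set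
open scoped Finset

open Classical in
theorem mul_measureReal_le_sum_inter {ι α : Type*} [MeasurableSpace α] {μ : Measure α}
    {F : Finset ι} {A : ι → Set α} {B : Set α} {m : ℕ} (hA : ∀ i ∈ F, MeasurableSet (A i))
    (hB : μ B ≠ ⊤) (hm : ∀ x ∈ B, m ≤ #{i ∈ F | x ∈ A i}) :
    m * μ.real B ≤ ∑ i ∈ F, μ.real (A i ∩ B) := by
  have hind : ∀ i ∈ F, Measurable ((A i).indicator (1 : α → ENNReal)) :=
    fun i hi => measurable_one.indicator (hA i hi)
  have hmeasure : (m : ENNReal) * μ B ≤ ∑ i ∈ F, μ (A i ∩ B) :=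
    calc (m : ENNReal) * μ B = ∫⁻ _ in B, (m : ENNReal) ∂μ := by simp
      _ ≤ ∫⁻ x in B, ∑ i ∈ F, (A i).indicator 1 x ∂μ := by
        refine setLIntegral_mono (Finset.measurable_sum _ hind) fun x hx => ?_
        simpa [indicator_apply] using hm x hx
      _ = ∑ i ∈ F, μ (A i ∩ B) := by
        rw [lintegral_finsetSum' _ fun i hi => (hind i hi).aemeasurable]
        refine Finset.sum_congr rfl fun i hi => ?_
        rw [lintegral_indicator_one (hA i hi), Measure.restrict_apply (hA i hi)]
  have hfin : ∀ i ∈ F, μ (A i ∩ B) ≠ ⊤ := fun i _ => measure_ne_top_of_subset inter_subset_right hB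
  have := ENNReal.toReal_mono (ENNReal.sum_ne_top.2 hfin) hmeasure
  rwa [ENNReal.toReal_mul, ENNReal.toReal_sum hfin, ENNReal.toReal_natCast] at this

namespace SporadicTask

variable (σ : SporadicTask)

/-- The bound `U L + C - C U` on the work of a task in an interval of length `L`: if the task has no
carry-in, the worst case is a release at the start of the interval and every `T` after that. -/
noncomputable def workBound (L : ℝ) : ℝ := σ.U * L + (σ.C - σ.C * σ.U)

theorem U_nonneg : 0 ≤ σ.U := div_nonneg σ.C_pos.le σ.T_pos.le

theorem U_mul_T : σ.U * σ.T = σ.C := div_mul_cancel₀ _ σ.T_pos.ne'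

theorem density_nonneg : 0 ≤ σ.density :=
  div_nonneg σ.C_pos.le (le_min σ.D_pos.le σ.T_pos.le)

theorem mul_C_add_le_workBound {q y L : ℝ} (hyC : y ≤ σ.C) (hyL : y ≤ L - q * σ.T) :
    q * σ.C + y ≤ σ.workBound L :=
  calc q * σ.C + y = q * σ.C + σ.U * y + (1 - σ.U) * y := by ring
    _ ≤ q * σ.C + σ.U * (L - q * σ.T) + (1 - σ.U) * σ.C := by
      gcongr
      exacts [σ.U_nonneg, sub_nonneg.2 σ.C_div_T_le_one]
    _ = σ.workBound L := by
      rw [workBound]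
      linear_combination -q * σ.U_mul_T

theorem succ_mul_C_le {V : ℝ} (hV : σ.density ≤ V) (n : ℕ) :
    (n + 1) * σ.C ≤ V * (n * σ.T + σ.D) := by
  have hmin : 0 < min σ.D σ.T := lt_min σ.D_pos σ.T_pos
  have hV0 : 0 ≤ V := σ.density_nonneg.trans hV
  calc (n + 1) * σ.C ≤ (n + 1) * (V * min σ.D σ.T) := by
        gcongr
        exact (div_le_iff₀ hmin).1 hV
    _ = V * (n * min σ.D σ.T + min σ.D σ.T) := by ring
    _ ≤ V * (n * σ.T + σ.D) := by
      gcongr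
      exacts [min_le_right _ _, min_le_left _ _]

end SporadicTask

namespace GlobalFP

section Occupancy

variable {A B : Set ℝ} {s t u v : ℝ}

/-- The Lebesgue measure of the part of `A` in `[s, t)`: the time that the activity which takes
place at the times in `A` occupies a processor during `[s, t)`. -/
noncomputable def occupancy (A : Set ℝ) (s t : ℝ) : ℝ := volume.real (A ∩ Ico s t)

theorem volume_inter_Ico_ne_top (A : Set ℝ) (s t : ℝ) : volume (A ∩ Ico s t) ≠ ⊤ :=
  measure_ne_top_of_subset inter_subset_right (by simp)

theorem occupancy_nonneg (A : Set ℝ) (s t : ℝ) : 0 ≤ occupancy A s t := measureReal_nonneg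

theorem occupancy_le_of_inter_subset (h : A ∩ Ico s t ⊆ B ∩ Ico u v) :
    occupancy A s t ≤ occupancy B u v :=
  measureReal_mono h (volume_inter_Ico_ne_top B u v)

theorem occupancy_anti_left (A : Set ℝ) (t : ℝ) : Antitone fun s => occupancy A s t :=
  fun _ _ h => occupancy_le_of_inter_subset
    (inter_subset_inter_right A (Ico_subset_Ico_left h))

theorem occupancy_mono_right (A : Set ℝ) (s : ℝ) : Monotone (occupancy A s) :=
  fun _ _ h => occupancy_le_of_inter_subset
    (inter_subset_inter_right A (Ico_subset_Ico_right h))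

theorem occupancy_eq_zero (h : ∀ x ∈ A, x ∉ Ico s t) : occupancy A s t = 0 := by
  rw [occupancy, (disjoint_left.2 h).inter_eq, measureReal_empty]

theorem occupancy_le_sub (A : Set ℝ) (h : s ≤ t) : occupancy A s t ≤ t - s := by
  rw [← Real.volume_real_Ico_of_le h]
  exact measureReal_mono inter_subset_right (by simp)

theorem occupancy_le_dist (A : Set ℝ) (s t : ℝ) : occupancy A s t ≤ dist s t := by
  rcases le_total s t with h | h
  · rw [dist_comm, Real.dist_eq]
    exact (occupancy_le_sub A h).trans (le_abs_self _)
  · rw [occupancy_eq_zero fun x _ hx => (hx.1.trans_lt hx.2).not_ge h]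
    exact dist_nonneg

theorem occupancy_le_add (A : Set ℝ) (s t u : ℝ) :
    occupancy A s u ≤ occupancy A s t + occupancy A t u := by
  refine (measureReal_mono ?_ (measure_union_ne_top (volume_inter_Ico_ne_top A s t)
    (volume_inter_Ico_ne_top A t u))).trans (measureReal_union_le _ _)
  rw [← inter_union_distrib_left]
  exact inter_subset_inter_right A Ico_subset_Ico_union_Ico

theorem occupancy_add (A : Set ℝ) (hst : s ≤ t) (htu : t ≤ u) :
    occupancy A s t + occupancy A t u = occupancy A s u := by
  rw [occupancy, occupancy, occupancy, ← measureReal_inter_add_sdiff (s := A ∩ Ico s u)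
    (measurableSet_Iio (a := t)) (volume_inter_Ico_ne_top A s u)]
  congr 2 <;> ext x <;> simp only [mem_inter_iff, mem_sdiff, Set.mem_Ico, Set.mem_Iio] <;> grind

theorem continuous_occupancy_left (A : Set ℝ) (t : ℝ) : Continuous fun s => occupancy A s t :=
  (LipschitzWith.of_le_add fun s u => by
    linarith [occupancy_le_add A s u t, occupancy_le_dist A s u]).continuous

theorem continuous_occupancy_right (A : Set ℝ) (s : ℝ) : Continuous (occupancy A s) :=
  (LipschitzWith.of_le_add fun t u => by
    linarith [occupancy_le_add A s u t, occupancy_le_dist A u t, dist_comm t u]).continuous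

end Occupancy

variable {N : ℕ}

section Jobs

variable {P : JobPattern N} {S : Schedule N} {τ : Fin N → SporadicTask} {i : Fin N} {j : ℕ}
  {s t : ℝ}

theorem Finished.mono (h : Finished P S i j s) (hst : s ≤ t) : Finished P S i j t :=
  h.trans (occupancy_mono_right _ _ hst)

theorem JobPattern.IsLegal.release_add_mul_le (hP : P.IsLegal τ) (i : Fin N) (j n : ℕ) :
    P.release i j + n * (τ i).T ≤ P.release i (j + n) := by
  induction n with
  | zero => simp
  | succ n ih =>
    have := hP.separation i (j + n)
    rw [← add_assoc]
    push_cast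
    linarith

theorem JobPattern.IsLegal.monotone_release (hP : P.IsLegal τ) (i : Fin N) :
    Monotone (P.release i) :=
  monotone_nat_of_le_succ fun j => by linarith [hP.separation i j, (τ i).T_pos]

theorem JobPattern.IsLegal.exists_le_release (hP : P.IsLegal τ) (i : Fin N) (s : ℝ) :
    ∃ j, s ≤ P.release i j := by
  obtain ⟨n, hn⟩ := exists_nat_ge (s / (τ i).T)
  rw [div_le_iff₀ (τ i).T_pos] at hn
  exact ⟨0 + n, by linarith [hP.release_add_mul_le i 0 n, hP.release_nonneg i 0]⟩

theorem Active.exists_ready (hmono : Monotone (P.release i)) (h : Active P S i t) :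
    ∃ j, Ready P S i j t := by
  classical
  obtain ⟨j, hj, hunfinished⟩ := h
  have hex : ∃ j, ¬ Finished P S i j t := ⟨j, hunfinished⟩
  exact ⟨Nat.find hex, (hmono (Nat.find_min' hex hunfinished)).trans hj, Nat.find_spec hex,
    fun j' hj' => not_not.1 (Nat.find_min hex hj')⟩

/-- No job of task `i` released before time `s` is still unfinished at `s`. -/
def NoCarryIn (P : JobPattern N) (S : Schedule N) (i : Fin N) (s : ℝ) : Prop :=
  ∀ j, P.release i j < s → Finished P S i j s

/-- Busy period of task `i`: an interval from the release of job `j` to `t` during which the task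
is always active, and at whose start all earlier jobs are finished. It is empty if `t` does not
exceed the release. -/
structure IsBusyPeriod (P : JobPattern N) (S : Schedule N) (i : Fin N) (j : ℕ) (t : ℝ) :
    Prop where
  finished_of_lt : ∀ j' < j, Finished P S i j' (P.release i j)
  active : ∀ u ∈ Ico (P.release i j) t, Active P S i u

theorem IsBusyPeriod.noCarryIn (h : IsBusyPeriod P S i j t) (hmono : Monotone (P.release i)) :
    NoCarryIn P S i (P.release i j) :=
  fun j' hj' => h.finished_of_lt j' (hmono.reflect_lt hj')

theorem exists_isBusyPeriod (hj : ¬ Finished P S i j t) : ∃ j₀ ≤ j, IsBusyPeriod P S i j₀ t := by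
  classical
  have hactive : ∀ u ∈ Ico (P.release i j) t, Active P S i u :=
    fun u hu => ⟨j, hu.1, fun h => hj (h.mono hu.2.le)⟩
  have hex : ∃ n, ∀ u ∈ Ico (P.release i n) t, Active P S i u := ⟨j, hactive⟩
  refine ⟨Nat.find hex, Nat.find_min' hex hactive, fun j' hj' => ?_, Nat.find_spec hex⟩
  -- An unfinished earlier job would extend the busy period to its own release.
  by_contra hunfinished
  refine Nat.find_min hex hj' fun u hu => ?_
  rcases le_or_gt (P.release i (Nat.find hex)) u with h | h
  · exact Nat.find_spec hex u ⟨h, hu.2⟩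
  · exact ⟨j', hu.1, fun hf => hunfinished (hf.mono h.le)⟩

end Jobs

namespace Schedule

/-- The times at which some job of task `i` is executed. -/
def running (S : Schedule N) (i : Fin N) : Set ℝ := ⋃ j, S i j

/-- The amount of execution that task `i` receives during `[s, t)`. -/
noncomputable def work (S : Schedule N) (i : Fin N) (s t : ℝ) : ℝ := occupancy (S.running i) s t

/-- The amount of execution that the tasks of higher priority than `k` receive during `[s, t)`. -/
noncomputable def higherPriorityWork (S : Schedule N) (k : Fin N) (s t : ℝ) : ℝ :=
  ∑ i ∈ Finset.Iio k, S.work i s t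

variable {S : Schedule N} {i k : Fin N} {s t u : ℝ}

theorem work_le_sum {F : Finset ℕ} (hF : ∀ j, ∀ x ∈ S i j, x ∈ Ico s t → j ∈ F) :
    S.work i s t ≤ ∑ j ∈ F, occupancy (S i j) s t := by
  have hsub : S.running i ∩ Ico s t ⊆ ⋃ j ∈ F, S i j ∩ Ico s t := by
    rintro x ⟨hx, hxs⟩
    obtain ⟨j, hj⟩ := mem_iUnion.1 hx
    exact mem_biUnion (hF j x hj hxs) ⟨hj, hxs⟩
  refine (measureReal_mono hsub ?_).trans (measureReal_biUnion_finset_le F _)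
  exact measure_ne_top_of_subset (iUnion₂_subset fun j _ => inter_subset_right)
    (by simp : volume (Ico s t) ≠ ⊤)

theorem higherPriorityWork_add (hst : s ≤ t) (htu : t ≤ u) :
    S.higherPriorityWork k s t + S.higherPriorityWork k t u = S.higherPriorityWork k s u := by
  rw [higherPriorityWork, higherPriorityWork, ← Finset.sum_add_distrib]
  exact Finset.sum_congr rfl fun i _ => occupancy_add _ hst htu

theorem work_add_higherPriorityWork_le (h : i < k) :
    S.work i s t + S.higherPriorityWork i s t ≤ S.higherPriorityWork k s t := by
  rw [higherPriorityWork, Finset.add_sum_Iio_eq_sum_Iic (f := fun h => S.work h s t)]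
  exact Finset.sum_le_sum_of_subset_of_nonneg (fun _ hh => Finset.mem_Iio.2
    ((Finset.mem_Iic.1 hh).trans_lt h)) fun _ _ _ => occupancy_nonneg _ _ _

theorem continuous_higherPriorityWork_left (S : Schedule N) (k : Fin N) (t : ℝ) :
    Continuous fun s => S.higherPriorityWork k s t :=
  continuous_finsetSum _ fun _ _ => continuous_occupancy_left _ t

theorem exists_earliest_loaded_start {a d ρ c : ℝ} (ha : 0 ≤ a) (had : a ≤ d)
    (hload : ρ * (d - a) ≤ S.higherPriorityWork k a d + c) :
    ∃ s ∈ Icc 0 a, ρ * (d - s) ≤ S.higherPriorityWork k s d + c ∧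
      ∀ u ∈ Ico 0 s, S.higherPriorityWork k u s < ρ * (s - u) := by
  have hclosed : IsClosed {s | ρ * (d - s) ≤ S.higherPriorityWork k s d + c} :=
    isClosed_le (by fun_prop) ((S.continuous_higherPriorityWork_left k d).add continuous_const)
  obtain ⟨s, ⟨hs, hsload⟩, hleast⟩ :=
    (isCompact_Icc.inter_right hclosed).exists_isLeast ⟨a, right_mem_Icc.2 ha, hload⟩
  refine ⟨s, hs, hsload, fun u hu => ?_⟩
  by_contra! hus
  refine hu.2.not_ge (hleast ⟨⟨hu.1, hu.2.le.trans hs.2⟩, ?_⟩)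
  have hsplit := S.higherPriorityWork_add (k := k) hu.2.le (hs.2.trans had)
  simp only [mem_ofPred_eq] at hsload ⊢
  linarith

end Schedule

namespace IsGlobalFPSchedule

variable {M : ℕ} {P : JobPattern N} {S : Schedule N} {τ : Fin N → SporadicTask} {i k : Fin N}
  {j : ℕ} {s t V : ℝ}

theorem measurableSet_running (hS : IsGlobalFPSchedule M P S) (i : Fin N) :
    MeasurableSet (S.running i) :=
  MeasurableSet.iUnion fun j => hS.measurable i j

theorem ready (hS : IsGlobalFPSchedule M P S) (h : t ∈ S i j) : Ready P S i j t :=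
  ((hS.executes_iff i j t).1 h).1

open Classical in
theorem le_card_running (hS : IsGlobalFPSchedule M P S) (hmono : ∀ h, Monotone (P.release h))
    (hactive : Active P S i t) (hidle : t ∉ S.running i) :
    M ≤ #{h ∈ Finset.Iio i | t ∈ S.running h} := by
  induction i using WellFoundedLT.induction with
  | ind i ih =>
    by_cases hall : ∀ h < i, Active P S h t → t ∈ S.running h
    · obtain ⟨j, hj⟩ := hactive.exists_ready (hmono i)
      have hnot : t ∉ S i j := fun h => hidle (mem_iUnion.2 ⟨j, h⟩)
      rw [hS.executes_iff, not_and, not_lt] at hnot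
      calc M ≤ {h | h < i ∧ Active P S h t}.ncard := hnot hj
        _ ≤ (({h ∈ Finset.Iio i | t ∈ S.running h} : Finset (Fin N)) : Set (Fin N)).ncard :=
          ncard_le_ncard fun h hh => by simpa using ⟨hh.1, hall h hh.1 hh.2⟩
        _ = #{h ∈ Finset.Iio i | t ∈ S.running h} := ncard_coe_finset _
    · push Not at hall
      obtain ⟨h, hhi, hh_active, hh_idle⟩ := hall
      exact (ih h hhi hh_active hh_idle).trans
        (Finset.card_le_card (Finset.filter_subset_filter _ (Finset.Iio_subset_Iio hhi.le)))

theorem mul_idle_le_higherPriorityWork (hS : IsGlobalFPSchedule M P S)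
    (hmono : ∀ h, Monotone (P.release h)) (hst : s ≤ t)
    (hactive : ∀ u ∈ Ico s t, Active P S i u) :
    M * (t - s - S.work i s t) ≤ S.higherPriorityWork i s t := by
  have hidle : volume.real (Ico s t \ S.running i) = t - s - S.work i s t := by
    have := measureReal_inter_add_sdiff (μ := volume) (s := Ico s t) (hS.measurableSet_running i)
      (by simp)
    rw [Real.volume_real_Ico_of_le hst, inter_comm] at this
    rw [Schedule.work, occupancy]
    linarith
  rw [← hidle]
  refine (mul_measureReal_le_sum_inter (fun h _ => hS.measurableSet_running h)
    (measure_ne_top_of_subset sdiff_subset (by simp)) fun x hx =>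
      hS.le_card_running hmono (hactive x hx.1) hx.2).trans (Finset.sum_le_sum fun h _ => ?_)
  exact measureReal_mono (inter_subset_inter_right _ sdiff_subset) (volume_inter_Ico_ne_top _ _ _)

theorem load_of_work_le (hS : IsGlobalFPSchedule M P S) (hmono : ∀ h, Monotone (P.release h))
    (hM : 0 < M) (hst : s ≤ t) (hactive : ∀ u ∈ Ico s t, Active P S i u)
    (hwork : S.work i s t ≤ V * (t - s)) :
    (M - (M - 1) * V) * (t - s) ≤ S.higherPriorityWork i s t + S.work i s t := by
  have hM' : (0 : ℝ) ≤ M - 1 := sub_nonneg.2 (Nat.one_le_cast.2 hM)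
  linarith [hS.mul_idle_le_higherPriorityWork hmono hst hactive,
    mul_le_mul_of_nonneg_left hwork hM']

theorem service_le_exec (hS : IsGlobalFPSchedule M P S) (hexec : 0 ≤ P.exec i j) (t : ℝ) :
    S.service i j t ≤ P.exec i j := by
  by_contra! hlt
  have hzero : occupancy (S i j) 0 0 = 0 := occupancy_eq_zero (by simp)
  obtain ⟨u, hu⟩ : ∃ u, occupancy (S i j) 0 u = P.exec i j :=
    mem_range_of_exists_le_of_exists_ge (continuous_occupancy_right (S i j) 0)
      ⟨0, hzero.le.trans hexec⟩ ⟨t, hlt.le⟩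
  have hdone : occupancy (S i j) u t = 0 := occupancy_eq_zero fun x hx hux =>
    (hS.ready hx).2.1 (Finished.mono hu.ge hux.1)
  have hservice : S.service i j t ≤ occupancy (S i j) 0 u + occupancy (S i j) u t :=
    occupancy_le_add _ _ _ _
  linarith

theorem occupancy_job_le (hS : IsGlobalFPSchedule M P S) (hP : P.IsLegal τ) (i : Fin N) (j : ℕ)
    (hs : 0 ≤ s) : occupancy (S i j) s t ≤ (τ i).C :=
  calc occupancy (S i j) s t ≤ S.service i j t := occupancy_anti_left _ _ hs
    _ ≤ P.exec i j := hS.service_le_exec (hP.exec_nonneg i j) t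
    _ ≤ (τ i).C := hP.exec_le i j

theorem work_le_mul_add (hS : IsGlobalFPSchedule M P S) (hP : P.IsLegal τ) (hs : 0 ≤ s) {n : ℕ}
    (hjobs : ∀ j', ∀ x ∈ S i j', x ∈ Ico s t → j' ∈ Ico j (j + (n + 1))) :
    S.work i s t ≤ n * (τ i).C + occupancy (S i (j + n)) s t :=
  calc S.work i s t ≤ ∑ j' ∈ Finset.Ico j (j + (n + 1)), occupancy (S i j') s t :=
        Schedule.work_le_sum fun j' x hx hxt => Finset.mem_Ico.2 (hjobs j' x hx hxt)
    _ = ∑ m ∈ Finset.range n, occupancy (S i (j + m)) s t + occupancy (S i (j + n)) s t := by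
      rw [Finset.sum_Ico_eq_sum_range, add_tsub_cancel_left, Finset.sum_range_succ]
    _ ≤ n * (τ i).C + occupancy (S i (j + n)) s t := by
      gcongr
      simpa using Finset.sum_le_card_nsmul (Finset.range n) _ (τ i).C
        fun m _ => hS.occupancy_job_le hP i (j + m) hs

theorem exists_first_job (hS : IsGlobalFPSchedule M P S) (hP : P.IsLegal τ)
    (hs : NoCarryIn P S i s) :
    ∃ j₀, s ≤ P.release i j₀ ∧ ∀ j, ∀ x ∈ S i j, s ≤ x → j₀ ≤ j := by
  classical
  have hex := hP.exists_le_release i s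
  refine ⟨Nat.find hex, Nat.find_spec hex, fun j x hx hsx => ?_⟩
  by_contra! hj
  exact (hS.ready hx).2.1 ((hs j (not_le.1 (Nat.find_min hex hj))).mono hsx)

theorem work_le_workBound_of_noCarryIn (hS : IsGlobalFPSchedule M P S) (hP : P.IsLegal τ)
    (hs : 0 ≤ s) (hst : s ≤ t) (hcarry : NoCarryIn P S i s) :
    S.work i s t ≤ (τ i).workBound (t - s) := by
  have hT := (τ i).T_pos
  obtain ⟨j₀, hj₀, hfirst⟩ := hS.exists_first_job hP hcarry
  set q := ⌊(t - s) / (τ i).T⌋₊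
  have hq_le : q * (τ i).T ≤ t - s := by
    rw [← le_div_iff₀ hT]
    exact Nat.floor_le (div_nonneg (sub_nonneg.2 hst) hT.le)
  have hq_lt : t - s < (q + 1) * (τ i).T := by
    rw [← div_lt_iff₀ hT]
    exact Nat.lt_floor_add_one _
  have hrelease : ∀ n : ℕ, s + n * (τ i).T ≤ P.release i (j₀ + n) := fun n => by
    linarith [hP.release_add_mul_le i j₀ n]
  have hjobs : ∀ j, ∀ x ∈ S i j, x ∈ Ico s t → j ∈ Ico j₀ (j₀ + (q + 1)) := by
    refine fun j x hx hxt => ⟨hfirst j x hx hxt.1, ?_⟩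
    by_contra! hj
    have hnext := hrelease (q + 1)
    push_cast at hnext
    linarith [(hS.ready hx).1, hP.monotone_release i hj, hxt.2]
  have hlast : occupancy (S i (j₀ + q)) s t ≤ t - s - q * (τ i).T :=
    calc occupancy (S i (j₀ + q)) s t ≤ occupancy (S i (j₀ + q)) (s + q * (τ i).T) t :=
          occupancy_le_of_inter_subset fun x hx =>
            ⟨hx.1, (hrelease q).trans (hS.ready hx.1).1, hx.2.2⟩
      _ ≤ t - (s + q * (τ i).T) := occupancy_le_sub _ (by linarith)
      _ = t - s - q * (τ i).T := by ring
  exact (hS.work_le_mul_add hP hs hjobs).trans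
    ((τ i).mul_C_add_le_workBound (hS.occupancy_job_le hP i _ hs) hlast)

theorem work_le_workBound_of_load_lt (hS : IsGlobalFPSchedule M P S) (hP : P.IsLegal τ)
    (hM : 0 < M) (hik : i < k) (hs : 0 ≤ s) (hst : s ≤ t) (hV : (τ i).U ≤ V)
    (hload : ∀ u ∈ Ico 0 s, S.higherPriorityWork k u s < (M - (M - 1) * V) * (s - u)) :
    S.work i s t ≤ (τ i).workBound (t - s) := by
  by_cases hcarry : NoCarryIn P S i s
  · exact hS.work_le_workBound_of_noCarryIn hP hs hst hcarry
  simp only [NoCarryIn, not_forall] at hcarry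
  obtain ⟨j, hjs, hj⟩ := hcarry
  obtain ⟨j₀, hj₀, hbusy⟩ := exists_isBusyPeriod hj
  set u := P.release i j₀
  have hu : 0 ≤ u := hP.release_nonneg i j₀
  have hus : u < s := (hP.monotone_release i hj₀).trans_lt hjs
  -- The carry-in has already been paid for by a rate of at least `V` on `[u, s)`.
  have hbefore : V * (s - u) < S.work i u s := by
    by_contra! hwork
    linarith [hload u ⟨hu, hus⟩, S.work_add_higherPriorityWork_le (s := u) (t := s) hik,
      hS.load_of_work_le hP.monotone_release hM hus.le hbusy.active hwork]
  have htotal : S.work i u t ≤ (τ i).workBound (t - u) :=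
    hS.work_le_workBound_of_noCarryIn hP hu (hus.le.trans hst)
      (hbusy.noCarryIn (hP.monotone_release i))
  have hsplit : S.work i u s + S.work i s t = S.work i u t := occupancy_add _ hus.le hst
  have hrate : (τ i).U * (s - u) ≤ V * (s - u) :=
    mul_le_mul_of_nonneg_right hV (sub_nonneg.2 hus.le)
  rw [SporadicTask.workBound] at htotal ⊢
  linarith

theorem work_lt_of_isBusyPeriod (hS : IsGlobalFPSchedule M P S) (hP : P.IsLegal τ) {n : ℕ}
    (hbusy : IsBusyPeriod P S i j t) (hmiss : ¬ Finished P S i (j + n) t) :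
    S.work i (P.release i j) t < (n + 1) * (τ i).C := by
  have hrelease := hP.release_nonneg i j
  have hjobs : ∀ j', ∀ x ∈ S i j', x ∈ Ico (P.release i j) t → j' ∈ Ico j (j + (n + 1)) := by
    refine fun j' x hx hxt => ⟨?_, ?_⟩ <;> by_contra! hj'
    · exact (hS.ready hx).2.1 ((hbusy.finished_of_lt j' hj').mono hxt.1)
    · exact hmiss (((hS.ready hx).2.2 (j + n) (by lia)).mono hxt.2.le)
  have hlast : occupancy (S i (j + n)) (P.release i j) t < (τ i).C :=
    calc occupancy (S i (j + n)) (P.release i j) t ≤ S.service i (j + n) t :=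
          occupancy_anti_left _ _ hrelease
      _ < P.exec i (j + n) := not_le.1 hmiss
      _ ≤ (τ i).C := hP.exec_le i _
  linarith [hS.work_le_mul_add hP hrelease hjobs]

theorem finished_deadline_of_forall_load_le (hS : IsGlobalFPSchedule M P S) (hP : P.IsLegal τ)
    (hM : 0 < M) (hVk : (τ k).density ≤ V) (hV : ∀ i < k, (τ i).U ≤ V)
    (hload : ∀ L, (τ k).D ≤ L →
      (τ k).C + (τ k).U * (L - (τ k).D) + ∑ i ∈ Finset.Iio k, (τ i).workBound L
        ≤ (M - (M - 1) * V) * L) (j : ℕ) :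
    Finished P S k j (P.release k j + (τ k).D) := by
  by_contra hmiss
  obtain ⟨j₀, hj₀, hbusy⟩ := exists_isBusyPeriod hmiss
  obtain ⟨n, rfl⟩ := Nat.exists_eq_add_of_le hj₀
  set d := P.release k (j₀ + n) + (τ k).D
  set a := P.release k j₀
  have ha : 0 ≤ a := hP.release_nonneg k j₀
  have hlength : n * (τ k).T + (τ k).D ≤ d - a := by linarith [hP.release_add_mul_le k j₀ n]
  have hD : (τ k).D ≤ d - a := by linarith [mul_nonneg n.cast_nonneg (τ k).T_pos.le]
  have had : a ≤ d := by linarith [(τ k).D_pos]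
  have hwork : S.work k a d < (n + 1) * (τ k).C := hS.work_lt_of_isBusyPeriod hP hbusy hmiss
  have hworkV : S.work k a d ≤ V * (d - a) :=
    calc S.work k a d ≤ (n + 1) * (τ k).C := hwork.le
      _ ≤ V * (n * (τ k).T + (τ k).D) := (τ k).succ_mul_C_le hVk n
      _ ≤ V * (d - a) := mul_le_mul_of_nonneg_left hlength ((τ k).density_nonneg.trans hVk)
  obtain ⟨s, ⟨hs, hsa⟩, hsload, hbefore⟩ := Schedule.exists_earliest_loaded_start ha had
    (hS.load_of_work_le hP.monotone_release hM had hbusy.active hworkV)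
  have hhigher : S.higherPriorityWork k s d ≤ ∑ i ∈ Finset.Iio k, (τ i).workBound (d - s) :=
    Finset.sum_le_sum fun i hi => hS.work_le_workBound_of_load_lt hP hM (Finset.mem_Iio.1 hi) hs
      (hsa.trans had) (hV i (Finset.mem_Iio.1 hi)) hbefore
  have hown : (n + 1) * (τ k).C ≤ (τ k).C + (τ k).U * (d - s - (τ k).D) :=
    calc (n + 1) * (τ k).C = (τ k).C + (τ k).U * (n * (τ k).T) := by
          rw [← (τ k).U_mul_T]
          ring
      _ ≤ (τ k).C + (τ k).U * (d - s - (τ k).D) := by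
        gcongr
        exacts [(τ k).U_nonneg, by linarith]
  linarith [hload (d - s) (by linarith)]

end IsGlobalFPSchedule

section SchedulabilityTest

variable {M : ℕ} {τ : Fin N → SporadicTask} {k : Fin N}

theorem U_le_UmaxDelta (τ : Fin N → SporadicTask) {i k : Fin N} (h : i < k) :
    (τ i).U ≤ UmaxDelta τ k :=
  (Finset.le_fold_max _).2 (Or.inr ⟨i, Finset.mem_Iio.2 h, le_rfl⟩)

theorem density_le_UmaxDelta (τ : Fin N → SporadicTask) (k : Fin N) :
    (τ k).density ≤ UmaxDelta τ k :=
  (Finset.le_fold_max _).2 (Or.inl le_rfl)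

theorem sum_workBound (τ : Fin N → SporadicTask) (k : Fin N) (L : ℝ) :
    ∑ i ∈ Finset.Iio k, (τ i).workBound L =
      (∑ i ∈ Finset.Iio k, (τ i).U) * L + ∑ i ∈ Finset.Iio k, ((τ i).C - (τ i).C * (τ i).U) := by
  simp only [SporadicTask.workBound, Finset.sum_add_distrib, Finset.sum_mul]

theorem schedulable_of_sum_U_le_of_load_le (hM : 0 < M)
    (hU : ∑ i ∈ Finset.Iic k, (τ i).U ≤ M - (M - 1) * UmaxDelta τ k)
    (hD : (τ k).C + ∑ i ∈ Finset.Iio k, (τ i).workBound (τ k).D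
      ≤ (M - (M - 1) * UmaxDelta τ k) * (τ k).D) :
    Schedulable M τ k := by
  refine fun P S hP hS => hS.finished_deadline_of_forall_load_le hP hM
    (density_le_UmaxDelta τ k) (fun i hi => U_le_UmaxDelta τ hi) fun L hL => ?_
  have hslope := mul_le_mul_of_nonneg_right hU (sub_nonneg.2 hL)
  rw [← Finset.add_sum_Iio_eq_sum_Iic] at hslope
  rw [sum_workBound] at hD ⊢
  linarith

theorem load_deadline_eq (τ : Fin N → SporadicTask) (k : Fin N) :
    (τ k).C + ∑ i ∈ Finset.Iio k, (τ i).workBound (τ k).D =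
      (∑ i ∈ Finset.Iic k, (τ i).U) * (τ k).D
        - (((τ k).D - (τ k).T) / (τ k).T * (τ k).U
            - ∑ i ∈ Finset.Iio k, ((τ i).C - (τ i).C * (τ i).U) / (τ k).T) * (τ k).T := by
  have hT := (τ k).T_pos.ne'
  rw [sum_workBound, ← Finset.add_sum_Iio_eq_sum_Iic, ← Finset.sum_div, ← (τ k).U_mul_T]
  field_simp
  ring

theorem load_deadline_div_eq (τ : Fin N → SporadicTask) (k : Fin N) :
    ((τ k).C + ∑ i ∈ Finset.Iio k, (τ i).workBound (τ k).D) / (τ k).D =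
      (τ k).C / (τ k).D
        + ∑ i ∈ Finset.Iio k, (((τ i).C - (τ i).C * (τ i).U) / (τ k).D + (τ i).U) := by
  have hD := (τ k).D_pos.ne'
  rw [sum_workBound, Finset.sum_add_distrib, ← Finset.sum_div]
  field_simp
  ring

end SchedulabilityTest

end GlobalFP

open GlobalFP in
theorem theorem4p6_general {N : ℕ} (τ : Fin N → SporadicTask) (M : ℕ) (hM : 0 < M) (k : Fin N)
    (b : ℝ) (hb : b = ((τ k).D - (τ k).T) / (τ k).T) :
    (0 < b * (τ k).U - ∑ i ∈ Finset.Iio k, ((τ i).C - (τ i).C * (τ i).U) / (τ k).T →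
      ∑ i ∈ Finset.Iic k, (τ i).U ≤ M - (M - 1) * UmaxDelta τ k →
      Schedulable M τ k) ∧
    (¬ 0 < b * (τ k).U - ∑ i ∈ Finset.Iio k, ((τ i).C - (τ i).C * (τ i).U) / (τ k).T →
      (τ k).C / (τ k).D
          + ∑ i ∈ Finset.Iio k, (((τ i).C - (τ i).C * (τ i).U) / (τ k).D + (τ i).U)
        ≤ M - (M - 1) * UmaxDelta τ k →
      Schedulable M τ k) := by
  have hD := (τ k).D_pos
  have hload := load_deadline_eq τ k
  rw [← hb] at hload
  refine ⟨fun hpos hU => schedulable_of_sum_U_le_of_load_le hM hU ?_, fun hnonpos hdiv => ?_⟩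
  · linarith [mul_pos hpos (τ k).T_pos, mul_le_mul_of_nonneg_right hU hD.le]
  · rw [← load_deadline_div_eq, div_le_iff₀ hD] at hdiv
    refine schedulable_of_sum_U_le_of_load_le hM (le_of_mul_le_mul_right ?_ hD) hdiv
    linarith [mul_nonpos_of_nonpos_of_nonneg (not_lt.1 hnonpos) (τ k).T_pos.le]

theorem theorem4p6 {N : ℕ} (τ : Fin N → SporadicTask) (M : ℕ) (hM : 2 ≤ M) (k : Fin N)
    (hDT : (τ k).T < (τ k).D) (b : ℝ) (hb : b = ((τ k).D - (τ k).T) / (τ k).T) :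
    (0 < b * (τ k).U - ∑ i ∈ Finset.Iio k, ((τ i).C - (τ i).C * (τ i).U) / (τ k).T →
      ∑ i ∈ Finset.Iic k, (τ i).U ≤ (M : ℝ) - ((M : ℝ) - 1) * GlobalFP.UmaxDelta τ k →
      GlobalFP.Schedulable M τ k) ∧
    (¬ 0 < b * (τ k).U - ∑ i ∈ Finset.Iio k, ((τ i).C - (τ i).C * (τ i).U) / (τ k).T →
      (τ k).C / (τ k).D
          + ∑ i ∈ Finset.Iio k, (((τ i).C - (τ i).C * (τ i).U) / (τ k).D + (τ i).U)
        ≤ (M : ℝ) - ((M : ℝ) - 1) * GlobalFP.UmaxDelta τ k →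
      GlobalFP.Schedulable M τ k) :=
  theorem4p6_general τ M (by lia) k b hb
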